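/- A *profinite dimensional manifold* is a second countable Hausdorff space $M=\varprojlim_{i\in\mathbb N}M_i$, where $(M_i,\mu_{ij})_{i\le j}$ is a projective system of smooth finite dimensional (Hausdorff) manifolds and surjective submersions $\mu_{ij}:M_j\to M_i$, and $M$ carries the initial topology of the canonical maps $\mu_i:M\to M_i$. A function on an open $U\subset M$ is smooth if it equals $g_i\circ\mu_i|_U$ for some $i$ and some smooth $g_i:\mu_i(U)\to\mathbb R$; a continuous map is smooth if it pulls back smooth functions on open sets to smooth functions. A map $f:N\to M$ is called a *smooth embedding* (resp. *diffeomorphism*) if, after passing to projective subsystems of the given systems $(N_i)$ and $(M_i)$, there are smooth embeddings (resp. diffeomorphisms) $f_i:N_i\to M_i$ with $f_i\circ\nu_i=\mu_i\circ f$ for all $i$. (Finite dimensional manifolds are the case of constant systems, where these are the usual notions.) Let $\mathfrak T$ be a subcategory of the category of profinite dimensional manifolds and smooth maps (more generally, a category with a faithful functor to it). An object with finite symmetries $(M,G)$ is an object $M$ of $\mathfrak T$ with an action of a finite group $G$ by automorphisms of $M$ in $\mathfrak T$ which are diffeomorphisms in the above sense. A morphism $(\varphi,\iota):(N,H)\to(M,G)$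 is a $\mathfrak T$-morphism $\varphi:N\to M$ together with a group homomorphism $\iota:H\to G$ such that $\varphi(hy)=\iota(h)\varphi(y)$ for all $h\in H$, $y\in N$; it induces $\overline\varphi:N/H\to M/G$. It is an *open embedding* if $\varphi$ is a smooth embedding and an open map, and $\overline\varphi$ is a homeomorphism onto an open subset of $M/G$. Two morphisms $(\varphi,\iota),(\varphi',\iota'):(N,H)\to(M,G)$ are *equivalent* if for some $g\in G$ one has $\varphi'=g\varphi$ and $\iota'(h)=g\,\iota(h)\,g^{-1}$ for all $h\in H$. **Theorem.** Let $(N,H)$ and $(M,G)$ be objects with finite symmetries, with $N$ and $M$ connected, and let $G$ act effectively on $M$. (SYM3) If moreover $H$ acts effectively on $N$, then two open embeddings $(\varphi,\iota),(\varphi',\iota'):(N,H)\to(M,G)$ are equivalent if and only if $\overline\varphi=\overline{\varphi'}$. (SYM4) Let $(\varphi,\iota):(N,H)\to(M,G)$ be an open embedding and let $g\in G$. If $g\varphi(N)\cap\varphi(N)\ne\emptyset$, then $g\varphi(N)=\varphi(N)$ and $g$ lies in the image of $\iota$. No assumption is made on the codimension of the strata of $(N,H)$ and $(M,G)$. -/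

import Mathlib

open CategoryTheory Topology
open scoped Manifold ContDiff

universe u v w

/-! ### Profinite dimensional manifolds -/

/-- A profinite dimensional manifold: a second countable Hausdorff space which is the projective
limit of a sequence of smooth finite dimensional manifolds with surjective submersions as
transition maps. -/
structure PFMan : Type (u + 1) where
  /-- the underlying space -/
  carrier : Type u
  [top : TopologicalSpace carrier]
  [t2 : T2Space carrier]
  [secondCountable : SecondCountableTopology carrier]
  /-- the dimension of the `i`-th manifold of the projective system -/
  dim : ℕ → ℕ
  /-- the `i`-th manifold of the projective system -/
  level : ℕ → Type u
  [levelTop : ∀ i, TopologicalSpace (level i)]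
  [levelT2 : ∀ i, T2Space (level i)]
  [levelCharted : ∀ i, ChartedSpace (EuclideanSpace ℝ (Fin (dim i))) (level i)]
  [levelManifold : ∀ i, IsManifold (𝓡 (dim i)) ∞ (level i)]
  /-- the transition map from level `j` to level `i ≤ j` -/
  trans : ∀ {i j : ℕ}, i ≤ j → level j → level i
  trans_refl : ∀ (i : ℕ) (x : level i), trans (le_refl i) x = x
  trans_trans : ∀ {i j k : ℕ} (hij : i ≤ j) (hjk : j ≤ k) (x : level k),
    trans hij (trans hjk x) = trans (hij.trans hjk) x
  trans_surjective : ∀ {i j : ℕ} (h : i ≤ j), Function.Surjective (trans h)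
  trans_submersion : ∀ {i j : ℕ} (h : i ≤ j),
    Manifold.IsSubmersion (𝓡 (dim j)) (𝓡 (dim i)) ∞ (trans h)
  /-- the canonical map from the limit to level `i` -/
  proj : ∀ i : ℕ, carrier → level i
  trans_proj : ∀ {i j : ℕ} (h : i ≤ j) (x : carrier), trans h (proj j x) = proj i x
  /-- the topology is the initial one with respect to the canonical maps -/
  isInducing : IsInducing (fun (x : carrier) (i : ℕ) => proj i x)
  /-- every compatible thread comes from exactly one point -/
  existsUnique_of_thread : ∀ t : (∀ i, level i),
    (∀ (i j : ℕ) (h : i ≤ j), trans h (t j) = t i) → ∃! x : carrier, ∀ i, proj i x = t i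

namespace PFMan

attribute [instance] top t2 secondCountable levelTop levelT2 levelCharted levelManifold

/-- `g` is a smooth real function on the (open) set `U`: it is the pullback of a smooth function
on the image of `U` in one of the manifolds of the projective system. -/
def IsSmoothFunOn (M : PFMan.{u}) (U : Set M.carrier) (g : M.carrier → ℝ) : Prop :=
  ∃ (i : ℕ) (γ : M.level i → ℝ),
    ContMDiffOn (𝓡 (M.dim i)) 𝓘(ℝ, ℝ) ∞ γ (M.proj i '' U) ∧ ∀ x ∈ U, g x = γ (M.proj i x)

/-- Smooth maps: continuous maps which pull back smooth functions on open sets to smooth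
functions. -/
def IsSmooth {N M : PFMan.{u}} (f : N.carrier → M.carrier) : Prop :=
  Continuous f ∧ ∀ (U : Set M.carrier) (g : M.carrier → ℝ), IsOpen U →
    M.IsSmoothFunOn U g → N.IsSmoothFunOn (f ⁻¹' U) (g ∘ f)

/-- The category of profinite dimensional manifolds and smooth maps. -/
instance : Category PFMan.{u} where
  Hom N M := {f : N.carrier → M.carrier // IsSmooth f}
  id M := ⟨id, continuous_id, fun _ _ _ hg => hg⟩
  comp f g := ⟨g.1 ∘ f.1, g.2.1.comp f.2.1, fun U h hU hh =>
    f.2.2 (g.1 ⁻¹' U) (h ∘ g.1) (hU.preimage g.2.1) (g.2.2 U h hU hh)⟩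

/-- Smooth embeddings of profinite dimensional manifolds: after passing to projective subsystems
(along `a` and `b`), the map is the limit of smooth embeddings of the manifolds of the two
systems. -/
def IsSmoothEmbedding {N M : PFMan.{u}} (f : N.carrier → M.carrier) : Prop :=
  ∃ (a b : ℕ → ℕ) (φ : ∀ i, N.level (a i) → M.level (b i)), StrictMono a ∧ StrictMono b ∧
    (∀ i, Manifold.IsSmoothEmbedding (𝓡 (N.dim (a i))) (𝓡 (M.dim (b i))) ∞ (φ i)) ∧
    ∀ i x, φ i (N.proj (a i) x) = M.proj (b i) (f x)

/-- Diffeomorphisms of profinite dimensional manifolds: after passing to projective subsystems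
(along `a` and `b`), the map is the limit of diffeomorphisms of the manifolds of the two
systems. -/
def IsDiffeomorphism {N M : PFMan.{u}} (f : N.carrier → M.carrier) : Prop :=
  ∃ (a b : ℕ → ℕ) (φ : ∀ i, Diffeomorph (𝓡 (N.dim (a i))) (𝓡 (M.dim (b i)))
      (N.level (a i)) (M.level (b i)) ∞), StrictMono a ∧ StrictMono b ∧
    ∀ i x, φ i (N.proj (a i) x) = M.proj (b i) (f x)

end PFMan

/-! ### Objects with finite symmetries

`T` is a category of profinite dimensional manifolds (possibly with extra structure) and smooth
maps, given by a faithful functor `F : T ⥤ PFMan`; the inclusion of a subcategory is an example.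
A finite group is a compact Lie group of dimension zero, with the discrete topology, so that
group homomorphisms carry no continuity condition. -/

/-- A `T`-object with symmetry group `G`: an object on which `G` acts by automorphisms in `T`
whose underlying maps are diffeomorphisms. -/
structure SymObj {T : Type w} [Category.{v} T] (F : T ⥤ PFMan.{u}) (G : Type*) [Group G] where
  /-- the underlying object -/
  obj : T
  /-- the action -/
  act : G →* Aut obj
  isDiffeomorphism : ∀ g : G, PFMan.IsDiffeomorphism (F.map (act g).hom).1

namespace SymObj

variable {T : Type w} [Category.{v} T] {F : T ⥤ PFMan.{u}} {G : Type*} [Group G]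

/-- The underlying topological space. -/
def Pt (M : SymObj F G) : Type u := (F.obj M.obj).carrier

instance (M : SymObj F G) : TopologicalSpace M.Pt :=
  inferInstanceAs (TopologicalSpace (F.obj M.obj).carrier)

/-- The action of `G` on the underlying space. -/
instance (M : SymObj F G) : MulAction G M.Pt where
  smul g x := (F.map (M.act g).hom).1 x
  one_smul x := by
    change (F.map (M.act 1).hom).1 x = x
    rw [map_one]
    change (F.map (𝟙 M.obj)).1 x = x
    rw [F.map_id]
    rfl
  mul_smul g h x := by
    change (F.map (M.act (g * h)).hom).1 x = (F.map (M.act g).hom).1 ((F.map (M.act h).hom).1 x)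
    rw [map_mul]
    change (F.map ((M.act h).hom ≫ (M.act g).hom)).1 x = _
    rw [F.map_comp]
    rfl

/-- The map on underlying spaces of a morphism of `T`. -/
def mapPt {H : Type*} [Group H] {N : SymObj F H} {M : SymObj F G} (φ : N.obj ⟶ M.obj) :
    N.Pt → M.Pt := (F.map φ).1

/-- The orbit space, with the quotient topology. -/
abbrev OrbitSpace (M : SymObj F G) : Type u := MulAction.orbitRel.Quotient G M.Pt

end SymObj

/-- A morphism `(φ, ι) : (N, H) → (M, G)`: a morphism `φ` of `T` and a group homomorphism `ι`
such that `φ (h y) = ι(h) φ (y)`. -/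
structure SymHom {T : Type w} [Category.{v} T] {F : T ⥤ PFMan.{u}} {H G : Type*} [Group H]
    [Group G] (N : SymObj F H) (M : SymObj F G) where
  /-- the morphism `φ` of `T` -/
  mor : N.obj ⟶ M.obj
  /-- the homomorphism `ι` -/
  ι : H →* G
  equivariant : ∀ (h : H) (y : N.Pt),
    SymObj.mapPt (M := M) mor (h • y) = ι h • SymObj.mapPt (M := M) mor y

namespace SymHom

variable {T : Type w} [Category.{v} T] {F : T ⥤ PFMan.{u}} {H G : Type*} [Group H] [Group G]
  {N : SymObj F H} {M : SymObj F G}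

/-- The map on underlying spaces. -/
def toFun (Φ : SymHom N M) : N.Pt → M.Pt := SymObj.mapPt Φ.mor

/-- The induced map on orbit spaces. -/
def orbitMap (Φ : SymHom N M) : N.OrbitSpace → M.OrbitSpace :=
  Quotient.map' Φ.toFun (by
    rintro _ y ⟨h, rfl⟩
    exact ⟨Φ.ι h, (Φ.equivariant h y).symm⟩)

/-- `(φ, ι)` is an embedding: `φ` is a smooth embedding and the induced map on orbit spaces is a
homeomorphism onto an open subset. -/
def IsEmbedding (Φ : SymHom N M) : Prop :=
  PFMan.IsSmoothEmbedding (F.map Φ.mor).1 ∧ Topology.IsOpenEmbedding Φ.orbitMap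

/-- `(φ, ι)` is an open embedding: an embedding with `φ` an open map. -/
def IsOpenEmbedding (Φ : SymHom N M) : Prop :=
  Φ.IsEmbedding ∧ IsOpenMap Φ.toFun

/-- `(φ', ι') = (g, Ad_g) (φ, ι)` for some `g` in `G`. -/
def Equivalent (Φ Φ' : SymHom N M) : Prop :=
  ∃ g : G, Φ'.mor = Φ.mor ≫ (M.act g).hom ∧ ∀ h : H, Φ'.ι h = g * Φ.ι h * g⁻¹

end SymHom

/-! ### Finite closed covers -/

/-! If the orbit maps of `φ` and `φ'` agree, the closed sets `C g = {φ' = g φ}` form a finite cover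
of `N`, so their interiors are jointly dense. Suppose the interiors of `C g` and `C k` both
accumulate at `y`, and put `f = g⁻¹ k`. Then `g⁻¹ φ'` has at `y` the value and derivative both of
`φ` and of `f φ`. As `φ` is open, it is submersive after projection to a level, so `f` fixes `φ(y)`
with derivative the identity. A finite-order map with this property is the identity on a connected
manifold, whence `g = k` by effectiveness. The closures of the interiors are thus disjoint, and
connectedness of `N` leaves a single `C g`. Derivatives are compared at the walls themselves, so
strata of codimension one do no harm (`IsDiffeomorphism.eq_id_of_mem_closure`).

For (SYM4), injectivity of the orbit map writes `{y | g φ(y) ∈ φ(N)}` as the finite union of the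
closed sets `{g φ = ι(h) φ}`. It is also open, hence all of `N`; one of these sets has interior, and
`g = ι(h)` because `φ` is open.

The profinite case reduces to finite dimensions because a finite-order diffeomorphism descends to
self-maps of cofinally many levels. -/

theorem dense_iUnion_interior_of_finite_closed_cover {X ι : Type*} [TopologicalSpace X] [Finite ι]
    {C : ι → Set X} (hC : ∀ i, IsClosed (C i)) (hcov : ⋃ i, C i = Set.univ) :
    Dense (⋃ i, interior (C i)) := by
  classical
  -- Frontiers of closed sets are nowhere dense, and a finite union of them stays so; off all
  -- frontiers, a point is interior to each member containing it.
  have key : ∀ s : Finset ι, interior (⋃ i ∈ s, frontier (C i)) = ∅ := by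
    intro s
    induction s using Finset.induction_on with
    | empty => simp
    | insert a s _ ih =>
      rw [Finset.set_biUnion_insert, interior_union_isClosed_of_interior_empty isClosed_frontier ih,
        interior_frontier (hC a)]
  cases nonempty_fintype ι
  have h := key Finset.univ
  rw [interior_eq_empty_iff_dense_compl] at h
  refine h.mono fun x hx => ?_
  obtain ⟨i, hi⟩ := Set.mem_iUnion.1 (hcov ▸ Set.mem_univ x)
  refine Set.mem_iUnion.2 ⟨i, ?_⟩
  by_contra hne
  refine hx (Set.mem_biUnion (Finset.mem_univ i) ?_)
  rw [(hC i).frontier_eq]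
  exact ⟨hi, hne⟩

/-- The closures of the interiors cover by density. Being finitely many, closed and disjoint, they
are clopen, so a nonempty one is everything. -/
theorem exists_eq_univ_of_finite_closed_cover {X ι : Type*} [TopologicalSpace X] [ConnectedSpace X]
    [Finite ι] {C : ι → Set X} (hC : ∀ i, IsClosed (C i)) (hcov : ⋃ i, C i = Set.univ)
    (hdisj : ∀ i j x, x ∈ closure (interior (C i)) → x ∈ closure (interior (C j)) → i = j) :
    ∃ i, C i = Set.univ := by
  have hcl : ⋃ i, closure (interior (C i)) = Set.univ := by
    rw [← closure_iUnion_of_finite]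
    exact (dense_iUnion_interior_of_finite_closed_cover hC hcov).closure_eq
  obtain ⟨x⟩ := (inferInstance : Nonempty X)
  obtain ⟨i, hi⟩ := Set.mem_iUnion.1 (hcl ▸ Set.mem_univ x)
  refine ⟨i, Set.eq_univ_of_univ_subset ?_⟩
  have hclopen : IsClopen (closure (interior (C i))) := by
    refine ⟨isClosed_closure, ?_⟩
    have : closure (interior (C i)) = (⋃ j : {j // j ≠ i}, closure (interior (C j)))ᶜ := by
      ext y
      simp only [Set.mem_compl_iff, Set.mem_iUnion, not_exists]
      constructor
      · intro hy j hj
        exact j.2 (hdisj _ _ y hj hy)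
      · intro hy
        obtain ⟨j, hj⟩ := Set.mem_iUnion.1 (hcl ▸ Set.mem_univ y)
        by_cases hji : j = i
        · exact hji ▸ hj
        · exact absurd hj (hy ⟨j, hji⟩)
    rw [this]
    exact (isClosed_iUnion_of_finite fun _ => isClosed_closure).isOpen_compl
  rw [← hclopen.eq_univ ⟨x, hi⟩]
  exact closure_minimal interior_subset (hC i)

/-! ### Smooth maps of finite order -/

section Manifold

variable {E E' E'' : Type*} [NormedAddCommGroup E] [NormedSpace ℝ E]
  [NormedAddCommGroup E'] [NormedSpace ℝ E'] [NormedAddCommGroup E''] [NormedSpace ℝ E'']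
  {X Y Z : Type*} [TopologicalSpace X] [ChartedSpace E X]
  [TopologicalSpace Y] [ChartedSpace E' Y]
  [TopologicalSpace Z] [ChartedSpace E'' Z]

theorem ContMDiffAt.contDiffAt_writtenInExtChartAt {f : X → Y} {x : X}
    (hf : ContMDiffAt 𝓘(ℝ, E) 𝓘(ℝ, E') ∞ f x) :
    ContDiffAt ℝ ∞ (writtenInExtChartAt 𝓘(ℝ, E) 𝓘(ℝ, E') x f) (extChartAt 𝓘(ℝ, E) x x) := by
  have h := (contMDiffAt_iff.1 hf).2
  rwa [modelWithCornersSelf_coe, Set.range_id, contDiffWithinAt_univ] at h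

theorem ContMDiffAt.mfderiv_eq_fderiv {f : X → Y} {x : X}
    (hf : ContMDiffAt 𝓘(ℝ, E) 𝓘(ℝ, E') ∞ f x) :
    mfderiv 𝓘(ℝ, E) 𝓘(ℝ, E') f x =
      fderiv ℝ (writtenInExtChartAt 𝓘(ℝ, E) 𝓘(ℝ, E') x f) (extChartAt 𝓘(ℝ, E) x x) := by
  rw [(hf.mdifferentiableAt (by simp)).mfderiv, modelWithCornersSelf_coe, Set.range_id,
    fderivWithin_univ]

theorem mfderiv_eq_of_mem_closure {f g : X → Y} {x : X}
    (hf : ContMDiffAt 𝓘(ℝ, E) 𝓘(ℝ, E') ∞ f x) (hg : ContMDiffAt 𝓘(ℝ, E) 𝓘(ℝ, E') ∞ g x)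
    (hx : f x = g x) {U : Set X} (hU : IsOpen U) (hfg : Set.EqOn f g U) (hxU : x ∈ closure U) :
    (mfderiv 𝓘(ℝ, E) 𝓘(ℝ, E') f x : E →L[ℝ] E') = mfderiv 𝓘(ℝ, E) 𝓘(ℝ, E') g x := by
  rw [hf.mfderiv_eq_fderiv, hg.mfderiv_eq_fderiv]
  have hf' := hf.contDiffAt_writtenInExtChartAt
  have hg' := hg.contDiffAt_writtenInExtChartAt
  set e := extChartAt 𝓘(ℝ, E) x with he
  set F := writtenInExtChartAt 𝓘(ℝ, E) 𝓘(ℝ, E') x f with hF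
  set G := writtenInExtChartAt 𝓘(ℝ, E) 𝓘(ℝ, E') x g with hG
  have hFG : Set.EqOn F G (e.symm ⁻¹' U) := by
    intro z hz
    simp only [hF, hG, writtenInExtChartAt, Function.comp, hx]
    rw [hfg hz]
  -- `hx` puts both maps in the same target chart, so their derivatives can be compared there as
  -- continuous functions that agree at points accumulating at `e x`.
  have hev : ∃ᶠ z in 𝓝 (e x), fderiv ℝ F z = fderiv ℝ G z := by
    refine (continuousAt_extChartAt (I := 𝓘(ℝ, E)) x).tendsto.frequently
      ((mem_closure_iff_frequently.1 hxU).and_eventually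
        (extChartAt_source_mem_nhds (I := 𝓘(ℝ, E)) x) |>.mono ?_)
    rintro p ⟨hpU, hp⟩
    refine Filter.EventuallyEq.fderiv_eq ?_
    have hc : ContinuousAt e.symm (e p) := continuousAt_extChartAt_symm' hp
    refine Filter.eventually_of_mem (hc.preimage_mem_nhds (hU.mem_nhds ?_)) hFG
    rwa [e.left_inv hp]
  have h1 : ContinuousAt (fderiv ℝ F) (e x) :=
    (hf'.fderiv_right (m := 0) (by simp)).continuousAt
  have h2 : ContinuousAt (fderiv ℝ G) (e x) :=
    (hg'.fderiv_right (m := 0) (by simp)).continuousAt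
  by_contra hne
  exact hev ((h1.prodMk h2).eventually ((isClosed_diagonal.isOpen_compl).mem_nhds hne))

theorem ContMDiff.iterate' {f : X → X} (hf : ContMDiff 𝓘(ℝ, E) 𝓘(ℝ, E) ∞ f) (n : ℕ) :
    ContMDiff 𝓘(ℝ, E) 𝓘(ℝ, E) ∞ f^[n] := by
  induction n with
  | zero => exact contMDiff_id
  | succ n ih => exact ih.comp hf

theorem mfderiv_iterate_eq_id {f : X → X} (hf : ContMDiff 𝓘(ℝ, E) 𝓘(ℝ, E) ∞ f) {x : X}
    (hx : f x = x) (hd : (mfderiv 𝓘(ℝ, E) 𝓘(ℝ, E) f x : E →L[ℝ] E) = ContinuousLinearMap.id ℝ E)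
    (n : ℕ) : (mfderiv 𝓘(ℝ, E) 𝓘(ℝ, E) f^[n] x : E →L[ℝ] E) = ContinuousLinearMap.id ℝ E := by
  induction n with
  | zero => exact mfderiv_id
  | succ n ih =>
    have h := mfderiv_comp x ((hf.iterate' n).mdifferentiableAt (by simp) (x := f x))
      (hf.mdifferentiableAt (by simp))
    rw [Function.iterate_succ]
    refine h.trans ?_
    rw [hx]
    ext v : 1
    change (mfderiv 𝓘(ℝ, E) 𝓘(ℝ, E) f^[n] x : E →L[ℝ] E)
      ((mfderiv 𝓘(ℝ, E) 𝓘(ℝ, E) f x : E →L[ℝ] E) v) = v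
    rw [ih, hd]
    rfl

/-- The sum `S` of chart values along an orbit is `f`-invariant, and its strict derivative at `x` is
`n • id`; hence `S` is injective near `x` and `p`, `f p` must coincide. -/
theorem eventually_eq_self_of_mfderiv_eq_id {f : X → X} (hf : ContMDiff 𝓘(ℝ, E) 𝓘(ℝ, E) ∞ f)
    {n : ℕ} (hn : 0 < n) (hfn : f^[n] = id) {x : X} (hx : f x = x)
    (hd : (mfderiv 𝓘(ℝ, E) 𝓘(ℝ, E) f x : E →L[ℝ] E) = ContinuousLinearMap.id ℝ E) :
    ∀ᶠ p in 𝓝 x, f p = p := by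
  set e := extChartAt 𝓘(ℝ, E) x with he
  set S : E → E := fun z => ∑ k ∈ Finset.range n, e (f^[k] (e.symm z)) with hS
  have hS' : HasStrictFDerivAt S (∑ _k ∈ Finset.range n, ContinuousLinearMap.id ℝ E) (e x) := by
    refine HasStrictFDerivAt.fun_sum fun k _ => ?_
    have hk := (hf.iterate' k).contMDiffAt (x := x)
    have h := hk.contDiffAt_writtenInExtChartAt.hasStrictFDerivAt (by simp)
    rw [← hk.mfderiv_eq_fderiv] at h
    have hdk := mfderiv_iterate_eq_id hf hx hd k
    have hw : writtenInExtChartAt 𝓘(ℝ, E) 𝓘(ℝ, E) x f^[k] = fun z => e (f^[k] (e.symm z)) := by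
      ext z
      simp [writtenInExtChartAt, Function.iterate_fixed hx, he]
    rw [hw] at h
    rw [← hdk]
    exact h
  -- Cyclic shift: the new term `k = n` equals the lost term `k = 0` since `f^[n] = id`.
  have hinv : ∀ p, ∑ k ∈ Finset.range n, e (f^[k] (f p)) = ∑ k ∈ Finset.range n, e (f^[k] p) := by
    intro p
    have h1 := Finset.sum_range_succ (fun k => e (f^[k] p)) n
    have h2 := Finset.sum_range_succ' (fun k => e (f^[k] p)) n
    rw [h1, hfn] at h2
    simpa using h2.symm
  have hc : Filter.Tendsto (fun p => (e p, e (f p))) (𝓝 x) (𝓝 (e x, e x)) := by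
    refine Filter.Tendsto.prodMk_nhds (continuousAt_extChartAt x) ?_
    have h1 : Filter.Tendsto f (𝓝 x) (𝓝 x) := by
      have := hf.continuous.continuousAt (x := x)
      rwa [ContinuousAt, hx] at this
    exact Filter.Tendsto.comp (continuousAt_extChartAt (I := 𝓘(ℝ, E)) x) h1
  -- With the `S`-values cancelling, this bound reads `n ‖e p - e (f p)‖ ≤ ½ ‖e p - e (f p)‖`; any
  -- constant below 1 would do, as `n ≥ 1`.
  have hlo := hc.eventually ((hS'.isLittleO.def (c := 1 / 2) (by norm_num)))
  have hsrc := extChartAt_source_mem_nhds (I := 𝓘(ℝ, E)) x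
  have hsrc' : ∀ᶠ p in 𝓝 x, f p ∈ e.source := by
    refine hf.continuous.continuousAt.preimage_mem_nhds ?_
    rw [hx]
    exact hsrc
  filter_upwards [hlo, hsrc, hsrc'] with p h1 h2 h3
  have hSeq : S (e p) = S (e (f p)) := by
    simp only [hS, e.left_inv h2, e.left_inv h3, hinv]
  have hsum : (∑ _k ∈ Finset.range n, ContinuousLinearMap.id ℝ E) (e p - e (f p))
      = (n : ℝ) • (e p - e (f p)) := by
    simp [Nat.cast_smul_eq_nsmul]
  simp only [hSeq, sub_self, zero_sub, norm_neg] at h1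
  rw [hsum, norm_smul, Real.norm_natCast] at h1
  have hn1 : (1 : ℝ) ≤ n := by exact_mod_cast hn
  have h0 : ‖e p - e (f p)‖ = 0 := by
    have := norm_nonneg (e p - e (f p))
    nlinarith
  exact (e.injOn h2 h3 (sub_eq_zero.1 (norm_eq_zero.1 h0))).symm

/-- The interior of the fixed set is closed: at a limit point the derivative is still the identity,
so the local statement applies again. -/
theorem eq_id_of_eventually_eq_self [T2Space X] [ConnectedSpace X] {f : X → X}
    (hf : ContMDiff 𝓘(ℝ, E) 𝓘(ℝ, E) ∞ f) {n : ℕ} (hn : 0 < n) (hfn : f^[n] = id) {x : X}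
    (hx : ∀ᶠ p in 𝓝 x, f p = p) : f = id := by
  have hclosed : IsClosed {p | f p = p} := isClosed_eq hf.continuous continuous_id
  have hclopen : IsClopen (interior {p | f p = p}) := by
    refine ⟨isClosed_of_closure_subset fun y hy => ?_, isOpen_interior⟩
    have hy' : f y = y := closure_minimal interior_subset hclosed hy
    rw [mem_interior_iff_mem_nhds]
    refine eventually_eq_self_of_mfderiv_eq_id hf hn hfn hy' ?_
    refine (mfderiv_eq_of_mem_closure hf.contMDiffAt contMDiffAt_id hy' isOpen_interior
      (fun z hz => interior_subset (s := {p | f p = p}) hz) hy).trans ?_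
    exact mfderiv_id
  have huniv := hclopen.eq_univ ⟨x, mem_interior_iff_mem_nhds.2 hx⟩
  ext1 p
  exact interior_subset (s := {p | f p = p}) (huniv ▸ Set.mem_univ p)

/-! ### Local sections -/

/-- `f` has a smooth local section through every point of its source. -/
def HasLocalSections (E E' : Type*) [NormedAddCommGroup E] [NormedSpace ℝ E]
    [NormedAddCommGroup E'] [NormedSpace ℝ E'] {X Y : Type*} [TopologicalSpace X]
    [ChartedSpace E X] [TopologicalSpace Y] [ChartedSpace E' Y] (f : X → Y) : Prop :=
  ∀ x, ∃ s : Y → X, s (f x) = x ∧ ContMDiffAt 𝓘(ℝ, E') 𝓘(ℝ, E) ∞ s (f x) ∧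
    ∀ᶠ y in 𝓝 (f x), f (s y) = y

theorem HasLocalSections.comp {g : Y → Z} {f : X → Y} (hg : HasLocalSections E' E'' g)
    (hf : HasLocalSections E E' f) : HasLocalSections E E'' (g ∘ f) := by
  intro x
  obtain ⟨s, hs, hsm, hse⟩ := hf x
  obtain ⟨t, ht, htm, hte⟩ := hg (f x)
  refine ⟨s ∘ t, by simp [ht, hs], ContMDiffAt.comp _ (by simpa [ht] using hsm) htm, ?_⟩
  have hc := htm.continuousAt.tendsto
  rw [ht] at hc
  filter_upwards [hte, hc.eventually hse] with y h1 h2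
  simp only [Function.comp] at h2 ⊢
  rw [h2, h1]

theorem HasLocalSections.isOpenMap {f : X → Y} (hf : HasLocalSections E E' f) : IsOpenMap f := by
  rw [isOpenMap_iff_nhds_le]
  intro x V hV
  obtain ⟨s, hs, hsm, hse⟩ := hf x
  have hc := hsm.continuousAt.tendsto
  rw [hs] at hc
  filter_upwards [hse, hc hV] with y h1 h2
  rw [← h1]
  exact h2

theorem HasLocalSections.mfderiv_surjective {f : X → Y} (hf : HasLocalSections E E' f)
    (hsm : ContMDiff 𝓘(ℝ, E) 𝓘(ℝ, E') ∞ f) (x : X) :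
    Function.Surjective (mfderiv 𝓘(ℝ, E) 𝓘(ℝ, E') f x : E →L[ℝ] E') := by
  obtain ⟨s, hs, hss, hse⟩ := hf x
  have h := mfderiv_comp (f x) (hsm.mdifferentiableAt (by simp) (x := s (f x)))
    (hss.mdifferentiableAt (by simp))
  have h' : mfderiv 𝓘(ℝ, E') 𝓘(ℝ, E') (f ∘ s) (f x) = mfderiv 𝓘(ℝ, E') 𝓘(ℝ, E') id (f x) :=
    Filter.EventuallyEq.mfderiv_eq hse
  rw [hs] at h
  intro v
  refine ⟨(mfderiv 𝓘(ℝ, E') 𝓘(ℝ, E) s (f x) : E' →L[ℝ] E) v, ?_⟩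
  have h3 : (mfderiv 𝓘(ℝ, E') 𝓘(ℝ, E') (f ∘ s) (f x) : E' →L[ℝ] E') v = v := by
    rw [h']
    exact congrArg (fun L : E' →L[ℝ] E' => L v) mfderiv_id
  exact (congrArg (fun L : E' →L[ℝ] E' => L v) h).symm.trans h3

/-- Serves submersions and open immersions alike: where `f` is linear in charts with right inverse
`R`, an affine section through `d x` is available. -/
theorem exists_local_section_of_charts {f : X → Y} {x : X}
    {d : OpenPartialHomeomorph X E} {c : OpenPartialHomeomorph Y E'}
    (hd : d ∈ IsManifold.maximalAtlas 𝓘(ℝ, E) ∞ X) (hc : c ∈ IsManifold.maximalAtlas 𝓘(ℝ, E') ∞ Y)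
    (hxd : x ∈ d.source) (hsub : d.source ⊆ f ⁻¹' c.source) (L : E →L[ℝ] E') (R : E' →L[ℝ] E)
    (hLR : ∀ v, L (R v) = v) (hf : Set.EqOn (c ∘ f ∘ d.symm) L d.target) :
    ∃ s : Y → X, s (f x) = x ∧ ContMDiffAt 𝓘(ℝ, E') 𝓘(ℝ, E) ∞ s (f x) ∧
      ∀ᶠ y in 𝓝 (f x), f (s y) = y := by
  have hfx : f x ∈ c.source := hsub hxd
  set r : E' → E := fun z => d x + R (z - c (f x)) with hr
  have hr0 : r (c (f x)) = d x := by simp [hr]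
  have hrs : ContDiff ℝ ∞ r := by fun_prop
  have hLd : L (d x) = c (f x) := by
    have := hf (d.map_source hxd)
    simpa [d.left_inv hxd] using this.symm
  have hsm1 : ContMDiffAt 𝓘(ℝ, E') 𝓘(ℝ, E) ∞ (r ∘ c) (f x) :=
    hrs.contMDiff.contMDiffAt.comp _ (contMDiffAt_of_mem_maximalAtlas hc hfx)
  have hsm2 : ContMDiffAt 𝓘(ℝ, E) 𝓘(ℝ, E) ∞ d.symm (d x) :=
    contMDiffAt_symm_of_mem_maximalAtlas hd (d.map_source hxd)
  refine ⟨d.symm ∘ (r ∘ c), by simp [hr0, d.left_inv hxd], ?_, ?_⟩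
  · exact ContMDiffAt.comp _ (by simpa [hr0] using hsm2) hsm1
  · have ht : ∀ᶠ y in 𝓝 (f x), r (c y) ∈ d.target := by
      have := hsm1.continuousAt.tendsto
      simp only [Function.comp, hr0] at this
      exact this (d.open_target.mem_nhds (d.map_source hxd))
    filter_upwards [ht, c.open_source.mem_nhds hfx] with y h1 h2
    have h3 : c (f (d.symm (r (c y)))) = L (r (c y)) := hf h1
    have h4 : L (r (c y)) = c y := by simp [hr, hLR, hLd]
    refine c.injOn (hsub (d.map_target h1)) h2 (h3.trans h4)

theorem Manifold.IsSubmersion.hasLocalSections {f : X → Y}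
    (hf : Manifold.IsSubmersion 𝓘(ℝ, E) 𝓘(ℝ, E') ∞ f) : HasLocalSections E E' f := by
  obtain ⟨F, _, _, hF⟩ := hf
  intro x
  obtain ⟨p⟩ := hF x
  obtain ⟨L, hL⟩ := p.property
  refine exists_local_section_of_charts p.domChart_mem_maximalAtlas p.codChart_mem_maximalAtlas
    p.mem_domChart_source p.source_subset_preimage_source
    ((ContinuousLinearMap.fst ℝ E' F).comp (L : E →L[ℝ] E' × F))
    ((L.symm : E' × F →L[ℝ] E).comp (ContinuousLinearMap.inl ℝ E' F)) (by simp) ?_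
  intro z hz
  have := hL (x := z) (by simpa using hz)
  simpa using this

theorem Manifold.IsImmersion.hasLocalSections_of_isOpenMap {f : X → Y}
    (hf : Manifold.IsImmersion 𝓘(ℝ, E) 𝓘(ℝ, E') ∞ f) (ho : IsOpenMap f) :
    HasLocalSections E E' f := by
  obtain ⟨F, _, _, hF⟩ := hf
  intro x
  obtain ⟨p⟩ := hF x
  obtain ⟨L, hL⟩ := p.property
  have hL' : Set.EqOn (p.codChart ∘ f ∘ p.domChart.symm) (fun z => L (z, 0)) p.domChart.target := by
    intro z hz
    have := hL (x := z) (by simpa using hz)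
    simpa using this
  have hopen : IsOpen (p.codChart '' (f '' p.domChart.source)) := by
    refine p.codChart.isOpen_image_of_subset_source (ho _ p.domChart.open_source) ?_
    rintro _ ⟨y, hy, rfl⟩
    exact p.source_subset_preimage_source hy
  have hopen2 : IsOpen (L.symm '' (p.codChart '' (f '' p.domChart.source))) :=
    L.symm.toHomeomorph.isOpenMap _ hopen
  have hzero : ∀ w ∈ L.symm '' (p.codChart '' (f '' p.domChart.source)), w.2 = 0 := by
    rintro _ ⟨_, ⟨_, ⟨y, hy, rfl⟩, rfl⟩, rfl⟩
    have := hL' (p.domChart.map_source hy)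
    simp only [Function.comp, p.domChart.left_inv hy] at this
    rw [this]
    simp
  -- The image lies in the slice `E × 0` yet is open, so it contains `w + t • (0, v)` for some `t ≠
  -- 0`. The normal directions therefore vanish.
  have hF0 : ∀ v : F, v = 0 := by
    intro v
    set w := L.symm (p.codChart (f x)) with hw
    have hwm : w ∈ L.symm '' (p.codChart '' (f '' p.domChart.source)) :=
      ⟨_, ⟨_, ⟨x, p.mem_domChart_source, rfl⟩, rfl⟩, rfl⟩
    have hc : Filter.Tendsto (fun t : ℝ => w + t • ((0, v) : E × F)) (𝓝[≠] 0) (𝓝 w) := by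
      have : Continuous (fun t : ℝ => w + t • ((0, v) : E × F)) := by fun_prop
      have h := this.tendsto 0
      simp only [zero_smul, add_zero] at h
      exact h.mono_left nhdsWithin_le_nhds
    obtain ⟨t, ht, ht0⟩ := ((hc.eventually (hopen2.mem_nhds hwm)).and
      eventually_mem_nhdsWithin).exists
    have h1 := hzero _ ht
    have h2 := hzero _ hwm
    simp only [Prod.snd_add, Prod.smul_snd, h2, zero_add] at h1
    exact (smul_eq_zero.1 h1).resolve_left ht0
  refine exists_local_section_of_charts p.domChart_mem_maximalAtlas p.codChart_mem_maximalAtlas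
    p.mem_domChart_source p.source_subset_preimage_source
    ((L : E × F →L[ℝ] E').comp (ContinuousLinearMap.inl ℝ E F))
    ((ContinuousLinearMap.fst ℝ E F).comp (L.symm : E' →L[ℝ] E × F)) ?_ ?_
  · intro v
    have : ((L.symm v).1, (0 : F)) = L.symm v := Prod.ext rfl (hF0 _).symm
    simp [this]
  · intro z hz
    simpa using hL' hz

end Manifold

/-! ### Profinite dimensional manifolds -/

namespace PFMan

variable (M : PFMan.{u}) {N : PFMan.{u}}

theorem contMDiff_trans {i j : ℕ} (h : i ≤ j) :
    ContMDiff (𝓡 (M.dim j)) (𝓡 (M.dim i)) ∞ (M.trans h) :=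
  (M.trans_submersion h).contMDiff

theorem hasLocalSections_trans {i j : ℕ} (h : i ≤ j) :
    HasLocalSections (EuclideanSpace ℝ (Fin (M.dim j))) (EuclideanSpace ℝ (Fin (M.dim i)))
      (M.trans h) :=
  (M.trans_submersion h).hasLocalSections

theorem continuous_proj (i : ℕ) : Continuous (M.proj i) :=
  (continuous_apply i).comp M.isInducing.continuous

/-- Only cofinally many levels are tested, since a symmetry need not descend to every level. -/
theorem ext_proj {x y : M.carrier} (h : ∀ d, ∃ i, d ≤ i ∧ M.proj i x = M.proj i y) : x = y := by
  refine (M.existsUnique_of_thread (fun i => M.proj i y) fun i j hij => M.trans_proj hij y).unique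
    (fun d => ?_) fun _ => rfl
  obtain ⟨i, hi, hxy⟩ := h d
  rw [← M.trans_proj hi, hxy, M.trans_proj hi]

theorem proj_surjective (i : ℕ) : Function.Surjective (M.proj i) := by
  intro x
  choose lift hlift using fun k => M.trans_surjective (Nat.le_succ (i + k))
  let s : ∀ k, M.level (i + k) := fun k => Nat.rec x (fun k y => lift k y) k
  have hs : ∀ j k (h : i + j ≤ i + k), M.trans h (s k) = s j := by
    intro j k h
    have hjk : j ≤ k := by omega
    induction k, hjk using Nat.le_induction with
    | base => exact M.trans_refl _ _
    | succ k hjk ih =>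
      rw [← M.trans_trans (show i + j ≤ i + k by omega) (Nat.le_succ (i + k))]
      exact (congrArg _ (hlift k (s k))).trans (ih _)
  -- Level `j` receives `s j` pushed down from level `i + j`, which avoids separating `j < i` from
  -- `j ≥ i`.
  obtain ⟨y, hy, -⟩ := M.existsUnique_of_thread
    (fun j => M.trans (Nat.le_add_left j i) (s j)) fun j k hjk => by
      rw [M.trans_trans, ← hs j k (by omega), M.trans_trans]
  refine ⟨y, ?_⟩
  rw [hy]
  exact hs 0 i (by omega)

/-- A basic neighbourhood involves finitely many levels, hence is controlled by one level `j` above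
them and above `i`, where the transition map to level `i` is open. -/
theorem isOpenMap_proj (i : ℕ) : IsOpenMap (M.proj i) := by
  rw [isOpenMap_iff_nhds_le]
  intro x V hV
  rw [Filter.mem_map, M.isInducing.nhds_eq_comap, nhds_pi, Filter.mem_comap] at hV
  obtain ⟨W, hW, hWV⟩ := hV
  obtain ⟨I, hI, t, ht, htW⟩ := Filter.mem_pi.1 hW
  obtain ⟨b, hb⟩ := hI.bddAbove
  set j := max i b with hj
  have hij : i ≤ j := le_max_left _ _
  have hbj : ∀ k ∈ I, k ≤ j := fun k hk => (hb hk).trans (le_max_right _ _)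
  have hnhds : ∀ᶠ z in 𝓝 (M.proj j x), ∀ k (hk : k ∈ I), M.trans (hbj k hk) z ∈ t k := by
    have : ∀ k ∈ I, ∀ᶠ z in 𝓝 (M.proj j x), ∀ hk : k ∈ I, M.trans (hbj k hk) z ∈ t k := by
      intro k hk
      have hc := (M.contMDiff_trans (hbj k hk)).continuous.tendsto (M.proj j x)
      rw [M.trans_proj] at hc
      filter_upwards [hc (ht k)] with z hz _ using hz
    exact (hI.eventually_all).2 this |>.mono fun z hz k hk => hz k hk hk
  have hopen := (isOpenMap_iff_nhds_le.1 (M.hasLocalSections_trans hij).isOpenMap) (M.proj j x)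
  rw [M.trans_proj] at hopen
  refine Filter.mem_of_superset (hopen (Filter.image_mem_map hnhds)) ?_
  rintro _ ⟨z, hz, rfl⟩
  obtain ⟨y, rfl⟩ := M.proj_surjective j z
  rw [M.trans_proj]
  refine hWV (htW fun k hk => ?_)
  have := hz k hk
  rwa [M.trans_proj] at this

theorem connectedSpace_level [ConnectedSpace M.carrier] (i : ℕ) : ConnectedSpace (M.level i) :=
  (M.proj_surjective i).connectedSpace (M.continuous_proj i)

variable {M}

/-- `f` induces smooth maps between the levels, up to passing to projective subsystems. -/
def IsLevelSmooth (f : N.carrier → M.carrier) : Prop :=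
  ∀ d, ∃ a, ∃ φ : N.level a → M.level d, ContMDiff (𝓡 (N.dim a)) (𝓡 (M.dim d)) ∞ φ ∧
    ∀ x, φ (N.proj a x) = M.proj d (f x)

theorem IsLevelSmooth.comp {P : PFMan.{u}} {g : M.carrier → P.carrier} {f : N.carrier → M.carrier}
    (hg : IsLevelSmooth g) (hf : IsLevelSmooth f) : IsLevelSmooth (g ∘ f) := by
  intro d
  obtain ⟨b, ψ, hψ, hψ'⟩ := hg d
  obtain ⟨a, φ, hφ, hφ'⟩ := hf b
  exact ⟨a, ψ ∘ φ, hψ.comp hφ, fun x => by simp [hφ', hψ']⟩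

theorem IsDiffeomorphism.isLevelSmooth {f : N.carrier → M.carrier} (hf : IsDiffeomorphism f) :
    IsLevelSmooth f := by
  obtain ⟨a, b, φ, -, hb, hφ⟩ := hf
  intro d
  exact ⟨a d, M.trans hb.le_apply ∘ φ d, (M.contMDiff_trans _).comp (φ d).contMDiff, fun x => by
    simp [hφ, M.trans_proj]⟩

theorem IsSmoothEmbedding.isLevelSmooth {f : N.carrier → M.carrier} (hf : IsSmoothEmbedding f) :
    IsLevelSmooth f := by
  obtain ⟨a, b, φ, -, hb, hsm, hφ⟩ := hf
  intro d
  exact ⟨a d, M.trans hb.le_apply ∘ φ d, (M.contMDiff_trans _).comp (hsm d).isImmersion.contMDiff,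
    fun x => by simp [hφ, M.trans_proj]⟩

/-- An open smooth embedding is a submersion on the levels. -/
theorem IsSmoothEmbedding.exists_hasLocalSections {f : N.carrier → M.carrier}
    (hf : IsSmoothEmbedding f) (ho : IsOpenMap f) (d : ℕ) :
    ∃ a, ∃ φ : N.level a → M.level d, ContMDiff (𝓡 (N.dim a)) (𝓡 (M.dim d)) ∞ φ ∧
      HasLocalSections (EuclideanSpace ℝ (Fin (N.dim a))) (EuclideanSpace ℝ (Fin (M.dim d))) φ ∧
      ∀ x, φ (N.proj a x) = M.proj d (f x) := by
  obtain ⟨a, b, φ, -, hb, hsm, hφ⟩ := hf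
  refine ⟨a d, M.trans hb.le_apply ∘ φ d,
    (M.contMDiff_trans _).comp (hsm d).isImmersion.contMDiff,
    (M.hasLocalSections_trans _).comp ((hsm d).isImmersion.hasLocalSections_of_isOpenMap ?_),
    fun x => by simp [hφ, M.trans_proj]⟩
  intro V hV
  have : φ d '' V = M.proj (b d) '' (f '' (N.proj (a d) ⁻¹' V)) := by
    rw [Set.image_image]
    simp only [← hφ]
    rw [← Set.image_image (φ d) (N.proj (a d)),
      Set.image_preimage_eq _ (N.proj_surjective (a d))]
  rw [this]
  exact M.isOpenMap_proj _ _ (ho _ (hV.preimage (N.continuous_proj _)))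

/-- A diffeomorphism of finite order acts on the manifolds of a cofinal family of levels. -/
theorem IsDiffeomorphism.exists_level_iterate_eq_id {f : M.carrier → M.carrier}
    (hf : IsDiffeomorphism f) {n : ℕ} (hn : 0 < n) (hfn : f^[n] = id) (d₀ : ℕ) :
    ∃ d, d₀ ≤ d ∧ ∃ ψ : M.level d → M.level d, ContMDiff (𝓡 (M.dim d)) (𝓡 (M.dim d)) ∞ ψ ∧
      ψ^[n] = id ∧ ∀ x, ψ (M.proj d x) = M.proj d (f x) := by
  have hiter : ∀ {d : ℕ} {ψ : M.level d → M.level d} {g : M.carrier → M.carrier},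
      (∀ x, ψ (M.proj d x) = M.proj d (g x)) → ∀ k x, ψ^[k] (M.proj d x) = M.proj d (g^[k] x) := by
    intro d ψ g h k x
    have : Function.Semiconj (M.proj d) g ψ := fun x => (h x).symm
    exact ((this.iterate_right k) x).symm
  have hid : ∀ {d : ℕ} {ψ : M.level d → M.level d},
      (∀ x, ψ (M.proj d x) = M.proj d (f x)) → ψ^[n] = id := by
    intro d ψ h
    ext1 z
    obtain ⟨x, rfl⟩ := M.proj_surjective d z
    rw [hiter h, hfn]
    rfl
  obtain ⟨a, b, φ, ha, hb, hφ⟩ := hf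
  -- `φ d₀` runs between two possibly different levels. It gives a self-map of the lower one:
  -- directly if that is the source, otherwise through its inverse, which induces `f⁻¹ = f^[n - 1]`,
  -- whose own `(n - 1)`-st iterate is `f`.
  rcases le_total (a d₀) (b d₀) with hab | hba
  · have hψ : ∀ x, (M.trans hab ∘ φ d₀) (M.proj (a d₀) x) = M.proj (a d₀) (f x) := fun x => by
      simp [hφ, M.trans_proj]
    exact ⟨a d₀, ha.le_apply, _, (M.contMDiff_trans hab).comp (φ d₀).contMDiff, hid hψ, hψ⟩
  · set g := f^[n - 1] with hg
    have hgf : ∀ x, f (g x) = x := fun x => by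
      rw [hg, ← Function.iterate_succ_apply' f, Nat.succ_eq_add_one, Nat.sub_add_cancel hn, hfn]
      rfl
    have hχ : ∀ x, (M.trans hba ∘ (φ d₀).symm) (M.proj (b d₀) x) = M.proj (b d₀) (g x) := by
      intro x
      have : (φ d₀).symm (M.proj (b d₀) x) = M.proj (a d₀) (g x) := by
        rw [← (φ d₀).symm_apply_apply (M.proj (a d₀) (g x)), hφ, hgf]
      simp [this, M.trans_proj]
    have hgn : g^[n - 1] = f := by
      have hgid : g^[n] = id := by
        rw [hg, ← Function.iterate_mul, mul_comm, Function.iterate_mul, hfn, Function.iterate_id]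
      ext1 x
      calc g^[n - 1] x = g^[n - 1] (g (f x)) := by
            rw [show g (f x) = x from
              ((Function.Commute.self_iterate f (n - 1)).eq x).symm.trans (hgf x)]
        _ = f x := by
            rw [← Function.iterate_succ_apply g, Nat.succ_eq_add_one, Nat.sub_add_cancel hn, hgid]
            rfl
    have hψ : ∀ x, (M.trans hba ∘ (φ d₀).symm)^[n - 1] (M.proj (b d₀) x) = M.proj (b d₀) (f x) :=
      fun x => by rw [hiter hχ, hgn]
    exact ⟨b d₀, hb.le_apply, _,
      ((M.contMDiff_trans hba).comp (φ d₀).symm.contMDiff).iterate' _, hid hψ, hψ⟩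

end PFMan

/-! ### Rigidity of finite-order diffeomorphisms -/

namespace PFMan

variable {M N : PFMan.{u}}

theorem IsDiffeomorphism.eq_id_of_eqOn [ConnectedSpace M.carrier] {f : M.carrier → M.carrier}
    (hf : IsDiffeomorphism f) {n : ℕ} (hn : 0 < n) (hfn : f^[n] = id) {U : Set M.carrier}
    (hU : IsOpen U) (hne : U.Nonempty) (hfU : Set.EqOn f id U) : f = id := by
  ext1 x
  refine M.ext_proj fun d₀ => ?_
  obtain ⟨d, hd, ψ, hψ, hψn, hψf⟩ := hf.exists_level_iterate_eq_id hn hfn d₀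
  have := M.connectedSpace_level d
  obtain ⟨y, hy⟩ := hne
  have hψid : ψ = id := by
    refine eq_id_of_eventually_eq_self hψ hn hψn (x := M.proj d y) ?_
    filter_upwards [(M.isOpenMap_proj d U hU).mem_nhds ⟨y, hy, rfl⟩]
    rintro _ ⟨z, hz, rfl⟩
    rw [hψf, hfU hz]
    rfl
  exact ⟨d, hd, by rw [← hψf, hψid]; rfl⟩

/-- At a point where `χ` passes from `φ` to `f ∘ φ`, continuity of the derivative gives `Dφ = Dχ =
Df ∘ Dφ` on a level; `Dφ` is surjective there, so `Df = id` and `f` is trivial on that level. -/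
theorem IsDiffeomorphism.eq_id_of_mem_closure [ConnectedSpace M.carrier]
    {f : M.carrier → M.carrier} (hf : IsDiffeomorphism f) {n : ℕ} (hn : 0 < n) (hfn : f^[n] = id)
    {φ χ : N.carrier → M.carrier} (hφ : IsSmoothEmbedding φ) (hφo : IsOpenMap φ)
    (hχ : IsLevelSmooth χ) {U V : Set N.carrier} (hU : IsOpen U) (hV : IsOpen V)
    (hχU : Set.EqOn χ φ U) (hχV : Set.EqOn χ (f ∘ φ) V) {y : N.carrier} (hyU : y ∈ closure U)
    (hyV : y ∈ closure V) : f = id := by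
  ext1 x
  refine M.ext_proj fun d₀ => ?_
  obtain ⟨d, hd, ψ, hψ, hψn, hψf⟩ := hf.exists_level_iterate_eq_id hn hfn d₀
  have := M.connectedSpace_level d
  obtain ⟨a₁, Φ₁, hΦ₁, hΦs₁, hΦφ₁⟩ := hφ.exists_hasLocalSections hφo d
  obtain ⟨a₂, X₂, hX₂, hXχ₂⟩ := hχ d
  -- A common source level, so that the derivatives of both level maps live on one tangent space.
  obtain ⟨a, h₁, h₂⟩ : ∃ a, a₁ ≤ a ∧ a₂ ≤ a := ⟨max a₁ a₂, le_max_left _ _, le_max_right _ _⟩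
  obtain ⟨Φ, hΦ, hΦs, hΦφ⟩ : ∃ Φ : N.level a → M.level d,
      ContMDiff (𝓡 (N.dim a)) (𝓡 (M.dim d)) ∞ Φ ∧
      HasLocalSections (EuclideanSpace ℝ (Fin (N.dim a))) (EuclideanSpace ℝ (Fin (M.dim d))) Φ ∧
      ∀ x, Φ (N.proj a x) = M.proj d (φ x) :=
    ⟨Φ₁ ∘ N.trans h₁, hΦ₁.comp (N.contMDiff_trans h₁), hΦs₁.comp (N.hasLocalSections_trans h₁),
      fun x => by simp [N.trans_proj, hΦφ₁]⟩
  obtain ⟨X, hX, hXχ⟩ : ∃ X : N.level a → M.level d,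
      ContMDiff (𝓡 (N.dim a)) (𝓡 (M.dim d)) ∞ X ∧ ∀ x, X (N.proj a x) = M.proj d (χ x) :=
    ⟨X₂ ∘ N.trans h₂, hX₂.comp (N.contMDiff_trans h₂), fun x => by simp [N.trans_proj, hXχ₂]⟩
  have hXU : Set.EqOn X Φ (N.proj a '' U) := by
    rintro _ ⟨z, hz, rfl⟩
    rw [hXχ, hΦφ, hχU hz]
  have hXV : Set.EqOn X (ψ ∘ Φ) (N.proj a '' V) := by
    rintro _ ⟨z, hz, rfl⟩
    rw [hXχ, Function.comp, hΦφ, hψf, hχV hz]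
    rfl
  have hcU := image_closure_subset_closure_image (N.continuous_proj a) ⟨y, hyU, rfl⟩
  have hcV := image_closure_subset_closure_image (N.continuous_proj a) ⟨y, hyV, rfl⟩
  have eU : X (N.proj a y) = Φ (N.proj a y) :=
    hXU.closure hX.continuous hΦ.continuous hcU
  have eV : X (N.proj a y) = ψ (Φ (N.proj a y)) :=
    hXV.closure hX.continuous (hψ.comp hΦ).continuous hcV
  have hfix : ψ (Φ (N.proj a y)) = Φ (N.proj a y) := eV.symm.trans eU
  have d₁ := mfderiv_eq_of_mem_closure hX.contMDiffAt hΦ.contMDiffAt eU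
    (N.isOpenMap_proj a U hU) hXU hcU
  have d₂ := mfderiv_eq_of_mem_closure hX.contMDiffAt (hψ.comp hΦ).contMDiffAt eV
    (N.isOpenMap_proj a V hV) hXV hcV
  have d₃ := mfderiv_comp (N.proj a y) (hψ.mdifferentiableAt (by simp) (x := Φ (N.proj a y)))
    (hΦ.mdifferentiableAt (by simp))
  have hψid : ψ = id := by
    refine eq_id_of_eventually_eq_self hψ hn hψn (x := Φ (N.proj a y))
      (eventually_eq_self_of_mfderiv_eq_id hψ hn hψn hfix ?_)
    ext1 v
    obtain ⟨v, rfl⟩ := hΦs.mfderiv_surjective hΦ (N.proj a y) v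
    exact (congrArg (fun L : EuclideanSpace ℝ (Fin (N.dim a)) →L[ℝ]
      EuclideanSpace ℝ (Fin (M.dim d)) => L v) ((d₂.trans d₃).symm.trans d₁))
  exact ⟨d, hd, by rw [← hψf, hψid]; rfl⟩

end PFMan

/-! ### Effective finite actions -/

namespace SymObj

variable {T : Type w} [Category.{v} T] {F : T ⥤ PFMan.{u}} {G : Type*} [Group G]

instance (M : SymObj F G) : T2Space M.Pt :=
  inferInstanceAs (T2Space (F.obj M.obj).carrier)

instance (M : SymObj F G) : ContinuousConstSMul G M.Pt where
  continuous_const_smul g := (F.map (M.act g).hom).2.1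

variable (M : SymObj F G)

theorem iterate_card_smul (g : G) : (fun x : M.Pt => g • x)^[Nat.card G] = id := by
  rw [smul_iterate]
  ext1 x
  simp

variable [Finite G] [ConnectedSpace M.Pt] [FaithfulSMul G M.Pt]

/-- Symmetries which agree on a nonempty open set are equal. -/
theorem eq_of_smul_eq_on_open {U : Set M.Pt} (hU : IsOpen U) (hne : U.Nonempty) {g g' : G}
    (h : ∀ x ∈ U, g • x = g' • x) : g = g' := by
  have : ConnectedSpace (F.obj M.obj).carrier := inferInstanceAs (ConnectedSpace M.Pt)
  have hid := (M.isDiffeomorphism (g⁻¹ * g')).eq_id_of_eqOn (n := Nat.card G) Nat.card_pos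
    (M.iterate_card_smul (g⁻¹ * g')) (U := U) hU hne fun (x : M.Pt) hx => by
      have hx' : (g⁻¹ * g') • (x : M.Pt) = x := by rw [mul_smul, ← h x hx, inv_smul_smul]
      exact hx'
  refine eq_of_inv_mul_eq_one (FaithfulSMul.eq_of_smul_eq_smul (α := M.Pt) fun x => ?_)
  rw [one_smul]
  exact congrFun hid x

end SymObj

/-! ### Open embeddings of objects with finite symmetries -/

namespace SymHom

variable {T : Type w} [Category.{v} T] {F : T ⥤ PFMan.{u}} {H G : Type*} [Group H] [Group G]
  {N : SymObj F H} {M : SymObj F G}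

theorem continuous_toFun (Φ : SymHom N M) : Continuous Φ.toFun := (F.map Φ.mor).2.1

theorem toFun_smul (Φ : SymHom N M) (h : H) (y : N.Pt) : Φ.toFun (h • y) = Φ.ι h • Φ.toFun y :=
  Φ.equivariant h y

theorem orbitMap_mk (Φ : SymHom N M) (y : N.Pt) :
    Φ.orbitMap (Quotient.mk'' y) = (Quotient.mk'' (Φ.toFun y) : M.OrbitSpace) := rfl

theorem orbit_mk_eq_iff (x y : M.Pt) :
    (Quotient.mk'' x : M.OrbitSpace) = Quotient.mk'' y ↔ ∃ g : G, g • y = x := by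
  rw [Quotient.eq'', MulAction.orbitRel_apply]
  rfl

theorem orbitMap_eq_of_equivalent {Φ Φ' : SymHom N M} (h : Φ.Equivalent Φ') :
    Φ.orbitMap = Φ'.orbitMap := by
  obtain ⟨g, hg, -⟩ := h
  ext1 y
  induction y using Quotient.inductionOn' with | h y => ?_
  rw [orbitMap_mk, orbitMap_mk, eq_comm, orbit_mk_eq_iff]
  refine ⟨g, ?_⟩
  change _ = (F.map Φ'.mor).1 y
  rw [hg, F.map_comp]
  rfl

theorem smul_range_eq_of_mem_range (Φ : SymHom N M) {g : G} (hg : g ∈ Φ.ι.range) :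
    (fun x => g • x) '' Set.range Φ.toFun = Set.range Φ.toFun := by
  obtain ⟨h, rfl⟩ := hg
  rw [← Set.range_comp]
  have : (fun x => Φ.ι h • x) ∘ Φ.toFun = Φ.toFun ∘ (fun y => h • y) :=
    funext fun y => (Φ.toFun_smul h y).symm
  rw [this, (MulAction.surjective h).range_comp]

variable [Finite G] [ConnectedSpace N.Pt] [ConnectedSpace M.Pt] [FaithfulSMul G M.Pt]

theorem exists_smul_eq_of_orbitMap_eq {Φ Φ' : SymHom N M} (hΦ : Φ.IsOpenEmbedding)
    (hΦ' : Φ'.IsOpenEmbedding) (h : Φ.orbitMap = Φ'.orbitMap) :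
    ∃ g : G, ∀ y, Φ'.toFun y = g • Φ.toFun y := by
  set C : G → Set N.Pt := fun g => {y | Φ'.toFun y = g • Φ.toFun y} with hC
  have hCc : ∀ g, IsClosed (C g) := fun g =>
    isClosed_eq Φ'.continuous_toFun (Φ.continuous_toFun.const_smul g)
  have hcov : ⋃ g, C g = Set.univ := by
    refine Set.eq_univ_of_forall fun y => Set.mem_iUnion.2 ?_
    have hy := congrFun h (Quotient.mk'' y)
    rw [orbitMap_mk, orbitMap_mk, eq_comm, orbit_mk_eq_iff] at hy
    obtain ⟨g, hg⟩ := hy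
    exact ⟨g, hg.symm⟩
  -- Translating by `g⁻¹` makes one of the two branches `φ` itself and the other `(g⁻¹ * k) φ`.
  obtain ⟨g, hg⟩ := exists_eq_univ_of_finite_closed_cover hCc hcov fun g k y hyg hyk => by
    have : ConnectedSpace (F.obj M.obj).carrier := inferInstanceAs (ConnectedSpace M.Pt)
    have hid := (M.isDiffeomorphism (g⁻¹ * k)).eq_id_of_mem_closure (n := Nat.card G) Nat.card_pos
      (M.iterate_card_smul (g⁻¹ * k)) (φ := Φ.toFun) (χ := fun z => g⁻¹ • Φ'.toFun z)
      hΦ.1.1 hΦ.2 ((M.isDiffeomorphism g⁻¹).isLevelSmooth.comp hΦ'.1.1.isLevelSmooth)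
      (U := interior (C g)) (V := interior (C k)) isOpen_interior isOpen_interior
      (fun z hz => by
        change g⁻¹ • Φ'.toFun z = Φ.toFun z
        rw [interior_subset (s := C g) hz, inv_smul_smul])
      (fun z hz => by
        change g⁻¹ • Φ'.toFun z = (g⁻¹ * k) • Φ.toFun z
        rw [interior_subset (s := C k) hz, mul_smul]) hyg hyk
    refine eq_of_inv_mul_eq_one (FaithfulSMul.eq_of_smul_eq_smul (α := M.Pt) fun x => ?_)
    rw [one_smul]
    exact congrFun hid x
  exact ⟨g, fun y => (hg ▸ Set.mem_univ y : y ∈ C g)⟩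

/-- Faithfulness of `F` lifts the pointwise identity to `T`. The homomorphisms are then forced,
because `Φ'.ι k` and `g * Φ.ι k * g⁻¹` act alike on the open image of `Φ'`. -/
theorem equivalent_of_orbitMap_eq [F.Faithful] {Φ Φ' : SymHom N M} (hΦ : Φ.IsOpenEmbedding)
    (hΦ' : Φ'.IsOpenEmbedding) (h : Φ.orbitMap = Φ'.orbitMap) : Φ.Equivalent Φ' := by
  obtain ⟨g, hg⟩ := exists_smul_eq_of_orbitMap_eq hΦ hΦ' h
  refine ⟨g, F.map_injective (Subtype.ext (funext fun y => ?_)), fun k => ?_⟩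
  · rw [F.map_comp]
    exact hg y
  · refine M.eq_of_smul_eq_on_open hΦ'.2.isOpen_range (Set.range_nonempty _) ?_
    rintro _ ⟨y, rfl⟩
    rw [← Φ'.toFun_smul, hg, hg, Φ.toFun_smul, mul_smul, mul_smul, inv_smul_smul]

theorem mem_range_of_smul_range_inter_nonempty [Finite H] {Φ : SymHom N M}
    (hΦ : Φ.IsOpenEmbedding) {g : G}
    (hg : (((fun x => g • x) '' Set.range Φ.toFun) ∩ Set.range Φ.toFun).Nonempty) :
    g ∈ Φ.ι.range := by
  set C : H → Set N.Pt := fun h => {y | g • Φ.toFun y = Φ.ι h • Φ.toFun y} with hC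
  have hCc : ∀ h, IsClosed (C h) := fun h =>
    isClosed_eq (Φ.continuous_toFun.const_smul g) (Φ.continuous_toFun.const_smul (Φ.ι h))
  have hCW : ⋃ h, C h = (fun y => g • Φ.toFun y) ⁻¹' Set.range Φ.toFun := by
    ext y
    simp only [Set.mem_iUnion, Set.mem_preimage, Set.mem_range]
    constructor
    · rintro ⟨h, hy⟩
      exact ⟨h • y, (Φ.toFun_smul h y).trans hy.symm⟩
    · rintro ⟨z, hz⟩
      have hzy : (Quotient.mk'' z : N.OrbitSpace) = Quotient.mk'' y :=
        hΦ.1.2.injective (by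
          rw [orbitMap_mk, orbitMap_mk, orbit_mk_eq_iff]
          exact ⟨g, hz.symm⟩)
      obtain ⟨h, rfl⟩ := (orbit_mk_eq_iff _ _).1 hzy
      exact ⟨h, hz.symm.trans (Φ.toFun_smul h y)⟩
  -- Closed as a finite union, open as the preimage of the open image of `Φ`.
  have hclopen : IsClopen (⋃ h, C h) :=
    ⟨isClosed_iUnion_of_finite hCc, hCW ▸
      hΦ.2.isOpen_range.preimage (Φ.continuous_toFun.const_smul g)⟩
  obtain ⟨_, ⟨_, ⟨y, rfl⟩, rfl⟩, hy⟩ := hg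
  have hcov := hclopen.eq_univ ⟨y, hCW ▸ hy⟩
  obtain ⟨z, hz⟩ := (dense_iUnion_interior_of_finite_closed_cover hCc hcov).nonempty
  obtain ⟨h, hz⟩ := Set.mem_iUnion.1 hz
  refine ⟨h, (M.eq_of_smul_eq_on_open (hΦ.2 _ (isOpen_interior (s := C h)))
    ⟨_, z, hz, rfl⟩ ?_).symm⟩
  rintro _ ⟨y, hy, rfl⟩
  exact (interior_subset hy : y ∈ C h)

end SymHom

theorem mainTheorem8 {T : Type w} [Category.{v} T] (F : T ⥤ PFMan.{u}) [F.Faithful]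
    {G H : Type*} [Group G] [Finite G] [Group H] [Finite H]
    (N : SymObj F H) (M : SymObj F G) [ConnectedSpace N.Pt] [ConnectedSpace M.Pt]
    [FaithfulSMul G M.Pt] :
    (FaithfulSMul H N.Pt → ∀ Φ Φ' : SymHom N M, Φ.IsOpenEmbedding → Φ'.IsOpenEmbedding →
      (Φ.Equivalent Φ' ↔ Φ.orbitMap = Φ'.orbitMap)) ∧
    (∀ Φ : SymHom N M, Φ.IsOpenEmbedding → ∀ g : G,
      (((fun x => g • x) '' Set.range Φ.toFun) ∩ Set.range Φ.toFun).Nonempty →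
      (fun x => g • x) '' Set.range Φ.toFun = Set.range Φ.toFun ∧ g ∈ Φ.ι.range) := by
  refine ⟨fun _ Φ Φ' hΦ hΦ' => ⟨SymHom.orbitMap_eq_of_equivalent,
    SymHom.equivalent_of_orbitMap_eq hΦ hΦ'⟩, fun Φ hΦ g hg => ?_⟩
  have h := SymHom.mem_range_of_smul_range_inter_nonempty hΦ hg
  exact ⟨Φ.smul_range_eq_of_mem_range h, h⟩
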